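/- Let $P=\{x\in\mathbb{R}^n : Ax\le b\}$ be a polytope (a bounded polyhedron), $0\le k\le n$, and let $\mathcal X=P\cap(\mathbb{Z}^k\times\mathbb{R}^{n-k})$ be nonempty. Let $\mathcal U=\{\xi\in\mathbb{R}^m : C\xi\le d\}$, with $C\in\mathbb{R}^{m'\times m}$ and $d\in\mathbb{R}^{m'}$, be a nonempty polytope. Let $f_1,f_2:\mathcal X\times\mathcal U\to\mathbb{R}$ be bilinear, i.e. linear in $x\in\mathcal X$ for each fixed $\xi\in\mathcal U$ and linear in $\xi\in\mathcal U$ for each fixed $x\in\mathcal X$, and write $f_i(x,\xi)=\hat c_i(x)^t\xi$ with $\hat c_i:\mathcal X\to\mathbb{R}^m$. Put $f^{\mathcal U}(x)=(\max_{\xi\in\mathcal U}f_1(x,\xi),\max_{\xi\in\mathcal U}f_2(x,\xi))$ and consider the robust biobjective problem $$\mathrm{BRO}(\mathcal U)\qquad \min_{x\in\mathcal X} f^{\mathcal U}(x),\qquad \mathcal Y:=f^{\mathcal U}(\mathcal X).$$ A point $y\in\mathcal Y$ is nondominated if no $y'\in\mathcal Y$ satisfies $y'\le y$ (componentwise) and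 $y'\ne y$. A point $y\in\mathcal Y$ is extreme supported nondominated if no convex combination $z$ of nondominated points different from $y$ satisfies $z\le y$; a nondominated point $y$ is supported if no such convex combination $z$ satisfies $z_1<y_1$ and $z_2<y_2$. Let $\mathcal Y_{\mathrm{ESN}}$ be the set of extreme supported nondominated points. A representative set of the extreme supported efficient solutions is a set $S\subseteq\mathcal X$ with $f^{\mathcal U}(S)=\mathcal Y_{\mathrm{ESN}}$. For $\lambda\in\mathbb{R}^2$ with $\lambda\geq 0$, $\lambda\neq 0$, let $$D(\mathcal U,\lambda)\qquad \min_{x\in\mathcal X,\ \pi^{(1)},\pi^{(2)}\in\mathbb{R}^{m'}}\Big\{d^t\sum_{i=1}^2\lambda_i\pi^{(i)} : C^t\pi^{(i)}=\hat c_i(x),\ \pi^{(i)}\ge 0,\ i=1,2\Big\},$$ and let $g_\lambda(x)$ be the minimum of the same program for fixed $x$. Algorithm DA is the following procedure. 1. Let $\epsilon_1$ be the optimal value of $D(\mathcal U,(1,0))$, choose $x^L\in\arg\min_{x\in\mathcal X}\{g_{(0,1)}(x): g_{(1,0)}(x)\le\epsilon_1\}$ and set $y^L=(\epsilon_1,g_{(0,1)}(x^L))$.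 Let $\epsilon_2$ be the optimal value of $D(\mathcal U,(0,1))$, choose $x^R\in\arg\min_{x\in\mathcal X}\{g_{(1,0)}(x): g_{(0,1)}(x)\le\epsilon_2\}$ and set $y^R=(g_{(1,0)}(x^R),\epsilon_2)$. 2. If $y^L=y^R$, return $Y^*=\{y^L\}$, $X^*=\{x^L\}$. Otherwise set $Y^*=\{y^L,y^R\}$, $X^*=\{x^L,x^R\}$, $\mathcal L=\{(y^L,y^R)\}$. 3. While $\mathcal L\ne\emptyset$: remove some $(y^l,y^r)$ from $\mathcal L$; put $\lambda=(y^l_2-y^r_2,\ y^r_1-y^l_1)$; choose an optimal solution $(x^*,\pi^{(1)},\pi^{(2)})$ of $D(\mathcal U,\lambda)$ and put $y^*=(d^t\pi^{(1)},d^t\pi^{(2)})$; if $\lambda^ty^*\ne\lambda^ty^l$, add $y^*$ to $Y^*$, $x^*$ to $X^*$, and $(y^l,y^*),(y^*,y^r)$ to $\mathcal L$. 4. Return $Y^*$ and $X^*$. Then Algorithm DA solves $\mathrm{BRO}(\mathcal U)$: whichever choices are made, all optimal values and solutions that it asks for exist, it terminates after finitely many iterations, and its output satisfies $\mathcal Y_{\mathrm{ESN}}\subseteq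 Y^*$, all points of $Y^*$ are supported nondominated points, $X^*\subseteq\mathcal X$ with $f^{\mathcal U}(X^*)=Y^*$, and $X^*$ contains a representative set of the extreme supported efficient solutions. -/

import Mathlib

open Matrix

/-- The polyhedron `{z : M z ≤ v}`, with `≤` understood componentwise. -/
def polyhedron {r n : ℕ} (M : Matrix (Fin r) (Fin n) ℝ) (v : Fin r → ℝ) : Set (Fin n → ℝ) :=
  {z | M *ᵥ z ≤ v}

/-- The mixed-integer set `P ∩ (ℤ^k × ℝ^(n-k))`. -/
def mixedIntegerPart {n : ℕ} (k : ℕ) (P : Set (Fin n → ℝ)) : Set (Fin n → ℝ) :=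
  {x | x ∈ P ∧ ∀ i : Fin n, (i : ℕ) < k → ∃ z : ℤ, x i = (z : ℝ)}

/-- `h : X × U → ℝ` is bilinear: on `X` it is linear in `x` for every fixed `ξ ∈ U`,
and on `U` it is linear in `ξ` for every fixed `x ∈ X`. -/
def IsBilinearOn {n m : ℕ} (X : Set (Fin n → ℝ)) (U : Set (Fin m → ℝ))
    (h : (Fin n → ℝ) → (Fin m → ℝ) → ℝ) : Prop :=
  (∀ ξ ∈ U, ∃ l : (Fin n → ℝ) →ₗ[ℝ] ℝ, ∀ x ∈ X, h x ξ = l x) ∧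
  (∀ x ∈ X, ∃ l : (Fin m → ℝ) →ₗ[ℝ] ℝ, ∀ ξ ∈ U, h x ξ = l ξ)

/-- The worst-case objective vector `f^U(x) = (sup_{ξ ∈ U} f₁(x,ξ), sup_{ξ ∈ U} f₂(x,ξ))`. -/
noncomputable def worstCase {n m : ℕ} (f : Fin 2 → (Fin n → ℝ) → (Fin m → ℝ) → ℝ)
    (U : Set (Fin m → ℝ)) (x : Fin n → ℝ) : Fin 2 → ℝ :=
  fun i => ⨆ ξ : U, f i x ξ

/-- `y` dominates `y'`: it is componentwise at most `y'` and different from `y'`. -/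
def Dominates (y y' : Fin 2 → ℝ) : Prop :=
  y ≤ y' ∧ y ≠ y'

/-- The nondominated points of a set `Y` of objective vectors. -/
def nondominatedPoints (Y : Set (Fin 2 → ℝ)) : Set (Fin 2 → ℝ) :=
  {y | y ∈ Y ∧ ¬ ∃ y' ∈ Y, Dominates y' y}

/-- The extreme supported nondominated points of `Y`: no convex combination of nondominated
points other than `y` is componentwise at most `y`. -/
def extremeSupportedPoints (Y : Set (Fin 2 → ℝ)) : Set (Fin 2 → ℝ) :=
  {y | y ∈ Y ∧ ¬ ∃ z ∈ convexHull ℝ (nondominatedPoints Y \ {y}), z ≤ y}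

/-- The supported nondominated points of `Y`: nondominated points `y` such that no convex
combination of nondominated points other than `y` is strictly smaller than `y` in every
component. -/
def supportedPoints (Y : Set (Fin 2 → ℝ)) : Set (Fin 2 → ℝ) :=
  {y | y ∈ nondominatedPoints Y ∧
    ¬ ∃ z ∈ convexHull ℝ (nondominatedPoints Y \ {y}), ∀ i, z i < y i}

/-- `S ⊆ X` is a representative set of the extreme supported efficient solutions of
`min_{x ∈ X} g(x)`: its image is the set of extreme supported nondominated points. -/
def IsRepresentativeESE {n : ℕ} (X : Set (Fin n → ℝ)) (g : (Fin n → ℝ) → Fin 2 → ℝ)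
    (S : Set (Fin n → ℝ)) : Prop :=
  S ⊆ X ∧ g '' S = extremeSupportedPoints (g '' X)

namespace DA

variable {n m q : ℕ}

/-- The dual variables `(π⁽¹⁾, π⁽²⁾)` that are feasible for `x`:
`Cᵀ π⁽ⁱ⁾ = ĉᵢ(x)` and `π⁽ⁱ⁾ ≥ 0` for `i = 1, 2`. -/
def dualFeasible (C : Matrix (Fin q) (Fin m) ℝ) (c : Fin 2 → (Fin n → ℝ) → Fin m → ℝ)
    (x : Fin n → ℝ) : Set (Fin 2 → Fin q → ℝ) :=
  {p | ∀ i, Cᵀ *ᵥ p i = c i x ∧ 0 ≤ p i}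

/-- The dual objective `dᵗ ∑ᵢ λᵢ π⁽ⁱ⁾`. -/
def dualObjective (d : Fin q → ℝ) (lam : Fin 2 → ℝ) (p : Fin 2 → Fin q → ℝ) : ℝ :=
  d ⬝ᵥ ∑ i, lam i • p i

/-- The feasible set of `D(U, λ)` (which does not depend on `λ`). -/
def feasible (X : Set (Fin n → ℝ)) (C : Matrix (Fin q) (Fin m) ℝ)
    (c : Fin 2 → (Fin n → ℝ) → Fin m → ℝ) : Set ((Fin n → ℝ) × (Fin 2 → Fin q → ℝ)) :=
  {w | w.1 ∈ X ∧ w.2 ∈ dualFeasible C c w.1}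

/-- `(x, π⁽¹⁾, π⁽²⁾)` is an optimal solution of `D(U, λ)`. -/
def IsOptimal (X : Set (Fin n → ℝ)) (C : Matrix (Fin q) (Fin m) ℝ) (d : Fin q → ℝ)
    (c : Fin 2 → (Fin n → ℝ) → Fin m → ℝ) (lam : Fin 2 → ℝ)
    (w : (Fin n → ℝ) × (Fin 2 → Fin q → ℝ)) : Prop :=
  w ∈ feasible X C c ∧
    ∀ w' ∈ feasible X C c, dualObjective d lam w.2 ≤ dualObjective d lam w'.2

/-- `e` is the optimal objective value of `D(U, λ)`. -/
def IsOptimalValue (X : Set (Fin n → ℝ)) (C : Matrix (Fin q) (Fin m) ℝ) (d : Fin q → ℝ)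
    (c : Fin 2 → (Fin n → ℝ) → Fin m → ℝ) (lam : Fin 2 → ℝ) (e : ℝ) : Prop :=
  ∃ w, IsOptimal X C d c lam w ∧ e = dualObjective d lam w.2

/-- `g_λ(x) = min {dᵗ ∑ᵢ λᵢ π⁽ⁱ⁾ : π feasible for x}`. -/
noncomputable def innerValue (C : Matrix (Fin q) (Fin m) ℝ) (d : Fin q → ℝ)
    (c : Fin 2 → (Fin n → ℝ) → Fin m → ℝ) (lam : Fin 2 → ℝ) (x : Fin n → ℝ) : ℝ :=
  sInf (dualObjective d lam '' dualFeasible C c x)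

/-- `x ∈ argmin_{x ∈ X} {h(x) : h'(x) ≤ e}`. -/
def IsConstrainedArgmin (X : Set (Fin n → ℝ)) (h h' : (Fin n → ℝ) → ℝ) (e : ℝ)
    (x : Fin n → ℝ) : Prop :=
  (x ∈ X ∧ h' x ≤ e) ∧ ∀ x' ∈ X, h' x' ≤ e → h x ≤ h x'

/-- The variables of the algorithm: the list `todo` of pairs `(yˡ, yʳ)` still to be examined,
the set `points` (that is, `Y*`) of points and the set `sols` (that is, `X*`) of solutions
found so far. -/
structure State (n : ℕ) where
  todo : Multiset ((Fin 2 → ℝ) × (Fin 2 → ℝ))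
  points : Set (Fin 2 → ℝ)
  sols : Set (Fin n → ℝ)

/-- The states in which the initialization (the computation of the two lexicographic optima)
can end. If the two lexicographically optimal points coincide, nothing is left to do. -/
inductive Init (X : Set (Fin n → ℝ)) (C : Matrix (Fin q) (Fin m) ℝ) (d : Fin q → ℝ)
    (c : Fin 2 → (Fin n → ℝ) → Fin m → ℝ) : State n → Prop
  | single (e₁ e₂ : ℝ) (xL xR : Fin n → ℝ) (yL yR : Fin 2 → ℝ)
      (he₁ : IsOptimalValue X C d c ![1, 0] e₁)
      (hxL : IsConstrainedArgmin X (innerValue C d c ![0, 1]) (innerValue C d c ![1, 0]) e₁ xL)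
      (hyL : yL = ![e₁, innerValue C d c ![0, 1] xL])
      (he₂ : IsOptimalValue X C d c ![0, 1] e₂)
      (hxR : IsConstrainedArgmin X (innerValue C d c ![1, 0]) (innerValue C d c ![0, 1]) e₂ xR)
      (hyR : yR = ![innerValue C d c ![1, 0] xR, e₂])
      (heq : yL = yR) :
      Init X C d c ⟨0, {yL}, {xL}⟩
  | pair (e₁ e₂ : ℝ) (xL xR : Fin n → ℝ) (yL yR : Fin 2 → ℝ)
      (he₁ : IsOptimalValue X C d c ![1, 0] e₁)
      (hxL : IsConstrainedArgmin X (innerValue C d c ![0, 1]) (innerValue C d c ![1, 0]) e₁ xL)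
      (hyL : yL = ![e₁, innerValue C d c ![0, 1] xL])
      (he₂ : IsOptimalValue X C d c ![0, 1] e₂)
      (hxR : IsConstrainedArgmin X (innerValue C d c ![1, 0]) (innerValue C d c ![0, 1]) e₂ xR)
      (hyR : yR = ![innerValue C d c ![1, 0] xR, e₂])
      (hne : yL ≠ yR) :
      Init X C d c ⟨{(yL, yR)}, {yL, yR}, {xL, xR}⟩

/-- The weight vector `λ = (yˡ₂ - yʳ₂, yʳ₁ - yˡ₁)`. -/
def weight (yl yr : Fin 2 → ℝ) : Fin 2 → ℝ :=
  ![yl 1 - yr 1, yr 0 - yl 0]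

/-- The point `y* = (dᵗ π⁽¹⁾, dᵗ π⁽²⁾)` read off from the dual variables. -/
def dualPoint (d : Fin q → ℝ) (p : Fin 2 → Fin q → ℝ) : Fin 2 → ℝ :=
  fun i => d ⬝ᵥ p i

/-- One iteration of the main loop: an arbitrary pair `(yˡ, yʳ)` is removed from the list, an
arbitrary optimal solution `(x*, π)` of `D(U, λ)` is computed, and `y*`, `x*` and the two new
pairs are added if `λᵗ y* ≠ λᵗ yˡ`. -/
inductive Step (X : Set (Fin n → ℝ)) (C : Matrix (Fin q) (Fin m) ℝ) (d : Fin q → ℝ)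
    (c : Fin 2 → (Fin n → ℝ) → Fin m → ℝ) : State n → State n → Prop
  | add (yl yr : Fin 2 → ℝ) (L : Multiset ((Fin 2 → ℝ) × (Fin 2 → ℝ)))
      (Y : Set (Fin 2 → ℝ)) (S : Set (Fin n → ℝ))
      (x : Fin n → ℝ) (p : Fin 2 → Fin q → ℝ)
      (hopt : IsOptimal X C d c (weight yl yr) (x, p))
      (hne : weight yl yr ⬝ᵥ dualPoint d p ≠ weight yl yr ⬝ᵥ yl) :
      Step X C d c ⟨(yl, yr) ::ₘ L, Y, S⟩
        ⟨(yl, dualPoint d p) ::ₘ (dualPoint d p, yr) ::ₘ L, insert (dualPoint d p) Y, insert x S⟩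
  | discard (yl yr : Fin 2 → ℝ) (L : Multiset ((Fin 2 → ℝ) × (Fin 2 → ℝ)))
      (Y : Set (Fin 2 → ℝ)) (S : Set (Fin n → ℝ))
      (x : Fin n → ℝ) (p : Fin 2 → Fin q → ℝ)
      (hopt : IsOptimal X C d c (weight yl yr) (x, p))
      (heq : weight yl yr ⬝ᵥ dualPoint d p = weight yl yr ⬝ᵥ yl) :
      Step X C d c ⟨(yl, yr) ::ₘ L, Y, S⟩ ⟨L, Y, S⟩

/-- The states that some run of the algorithm reaches. -/
def Reachable (X : Set (Fin n → ℝ)) (C : Matrix (Fin q) (Fin m) ℝ) (d : Fin q → ℝ)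
    (c : Fin 2 → (Fin n → ℝ) → Fin m → ℝ) (s : State n) : Prop :=
  ∃ s₀, Init X C d c s₀ ∧ Relation.ReflTransGen (Step X C d c) s₀ s

end DA

/-! By linear programming duality, for each `x` the worst-case vector `worstCase f U x` is the
componentwise least dual point: the two dual vectors are chosen independently, so one choice is
optimal for every `λ ≥ 0` (`isDualValue_worstCase`). Thus `D(U, λ)` minimizes the weighted sum of
the robust objectives over `X`, and the procedure is dichotomic search on `Y = worstCase f U '' X`.

Existence and termination rest on `exists_finite_subset_image_worstCase`: `X` splits into finitely
many polytopes on which the worst-case objective is linear, so `Y` lies in the convex hull of a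
finite `V ⊆ Y`. Linear minima over `Y` are then attained in `V`.

Every point found is minimal in `convexHull ℝ Y` (`IsHullMinimal`), hence supported. If a weighted
minimizer lies below the line through `yˡ` and `yʳ`, it lies strictly between them and each new pair
encloses fewer points of `V` (`ncard_pointsBetween_lt`). Otherwise the line supports `Y` and no
extreme supported point lies strictly between (`IsHullMinimal.not_extreme_between`), so the pair can
be dropped. The invariant `LoopInvariant` records that each extreme supported point is either found
or enclosed by a pending pair. -/

/-! ### Farkas' lemma and linear programming duality -/

/-- Farkas' lemma for finitely many linear functionals. -/
theorem farkas_finset {ι W : Type*} [AddCommGroup W] [Module ℝ W] (s : Finset ι) :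
    ∀ (a : ι → W →ₗ[ℝ] ℝ) (c : W →ₗ[ℝ] ℝ), (∀ x, (∀ i ∈ s, a i x ≤ 0) → c x ≤ 0) →
      ∃ u : ι → ℝ, (∀ i, 0 ≤ u i) ∧ c = ∑ i ∈ s, u i • a i := by
  classical
  induction s using Finset.induction_on with
  | empty =>
    intro a c h
    refine ⟨0, fun _ => le_rfl, ?_⟩
    ext x
    have h1 := h x (by simp)
    have h2 := h (-x) (by simp)
    rw [map_neg] at h2
    simp only [Finset.sum_empty, LinearMap.zero_apply]
    linarith
  | insert j s hj ih =>
    intro a c h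
    by_cases hc : ∀ x, (∀ i ∈ s, a i x ≤ 0) → c x ≤ 0
    · obtain ⟨u, hu, hcu⟩ := ih a c hc
      refine ⟨Function.update u j 0, fun i => ?_, ?_⟩
      · by_cases hij : i = j
        · subst hij; simp
        · simp [Function.update_of_ne hij, hu i]
      · rw [Finset.sum_insert hj, hcu]
        simp only [Function.update_self, zero_smul, zero_add]
        refine Finset.sum_congr rfl fun i hi => ?_
        rw [Function.update_of_ne (ne_of_mem_of_not_mem hi hj)]
    · push Not at hc
      obtain ⟨x₁, hx₁, hcx₁⟩ := hc
      have hpos : 0 < a j x₁ := by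
        by_contra hle
        refine absurd (h x₁ fun i hi => ?_) (not_le.2 hcx₁)
        rcases Finset.mem_insert.1 hi with rfl | hi
        · exact not_lt.1 hle
        · exact hx₁ i hi
      obtain ⟨x₀, hx₀, hcx₀, hone⟩ : ∃ x₀, (∀ i ∈ s, a i x₀ ≤ 0) ∧ 0 < c x₀ ∧ a j x₀ = 1 := by
        refine ⟨(a j x₁)⁻¹ • x₁, fun i hi => ?_, ?_, ?_⟩
        · simpa using mul_nonpos_of_nonneg_of_nonpos (inv_pos.2 hpos).le (hx₁ i hi)
        · simpa using mul_pos (inv_pos.2 hpos) hcx₁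
        · simp [hpos.ne']
      -- These functionals are `a i` and `c` composed with the projection `x ↦ x - a j x • x₀` onto
      -- the kernel of `a j`, where the `j`-th constraint holds trivially.
      obtain ⟨u, hu, hcu⟩ := ih (fun i => a i - a i x₀ • a j) (c - c x₀ • a j) fun x hx => by
        have := h (x - a j x • x₀) fun i hi => by
          rcases Finset.mem_insert.1 hi with rfl | hi
          · simp [hone]
          · have := hx i hi
            simp only [LinearMap.sub_apply, LinearMap.smul_apply, smul_eq_mul, map_sub,
              map_smul] at this ⊢
            linarith
        simp only [LinearMap.sub_apply, LinearMap.smul_apply, smul_eq_mul, map_sub,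
          map_smul] at this ⊢
        linarith
      -- The coefficient of `a j` is what remains after expanding the projected identity; it is
      -- nonnegative because `c x₀ > 0` and `a i x₀ ≤ 0` on `s`.
      refine ⟨Function.update u j (c x₀ - ∑ i ∈ s, u i * a i x₀), fun i => ?_, ?_⟩
      · by_cases hij : i = j
        · subst hij
          simp only [Function.update_self, sub_nonneg]
          exact (Finset.sum_nonpos fun k hk =>
            mul_nonpos_of_nonneg_of_nonpos (hu k) (hx₀ k hk)).trans hcx₀.le
        · simp [Function.update_of_ne hij, hu i]
      · rw [Finset.sum_insert hj, Function.update_self]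
        have hs : ∑ i ∈ s, Function.update u j (c x₀ - ∑ i ∈ s, u i * a i x₀) i • a i
            = ∑ i ∈ s, u i • a i := Finset.sum_congr rfl fun i hi => by
          rw [Function.update_of_ne (ne_of_mem_of_not_mem hi hj)]
        rw [hs]
        ext x
        have := LinearMap.congr_fun hcu x
        simp only [smul_sub, Finset.sum_sub_distrib, LinearMap.add_apply, LinearMap.sub_apply,
          LinearMap.smul_apply, LinearMap.sum_apply, smul_eq_mul, sub_mul, Finset.sum_mul,
          mul_assoc] at this ⊢
        linarith

/-- Strong duality: a linear upper bound on a nonempty polyhedron is certified by a nonnegative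
combination of the defining inequalities. -/
theorem exists_dual_of_le_on_polyhedron {q m : ℕ} (C : Matrix (Fin q) (Fin m) ℝ) (d : Fin q → ℝ)
    (hne : (polyhedron C d).Nonempty) (c : Fin m → ℝ) (w : ℝ)
    (h : ∀ ξ ∈ polyhedron C d, c ⬝ᵥ ξ ≤ w) :
    ∃ p : Fin q → ℝ, 0 ≤ p ∧ Cᵀ *ᵥ p = c ∧ d ⬝ᵥ p ≤ w := by
  let dotL : (Fin m → ℝ) → (Fin m → ℝ) →ₗ[ℝ] ℝ := fun v => dotProductBilin ℝ ℝ v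
  have hdot : ∀ v ξ, dotL v ξ = v ⬝ᵥ ξ := fun v ξ => rfl
  let F : (Fin m → ℝ) → ℝ → ((Fin m → ℝ) × ℝ) →ₗ[ℝ] ℝ := fun v t =>
    (dotL v).comp (LinearMap.fst ℝ _ _) - t • LinearMap.snd ℝ _ _
  have hF : ∀ v t ξ r, F v t (ξ, r) = v ⬝ᵥ ξ - t * r := fun v t ξ r => rfl
  -- Homogenization: `c ⬝ᵥ ξ ≤ w * t` follows from `C ξ ≤ t d` and `t ≥ 0`, the latter being the
  -- constraint indexed by `none`.
  obtain ⟨u, hu, hcu⟩ := farkas_finset (Finset.univ : Finset (Option (Fin q)))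
    (fun o => o.elim (F 0 1) fun j => F (C j) (d j)) (F c w) (by
      rintro ⟨ξ, t⟩ hx
      have ht : 0 ≤ t := by
        have := hx none (Finset.mem_univ _)
        simp only [Option.elim_none, hF, zero_dotProduct] at this
        linarith
      have hC : ∀ j, C j ⬝ᵥ ξ ≤ d j * t := fun j => by
        have := hx (some j) (Finset.mem_univ _)
        simp only [Option.elim_some, hF] at this
        linarith
      rw [hF]
      rcases ht.eq_or_lt with rfl | ht
      -- For `t = 0`, `ξ` is a recession direction. Were `c ⬝ᵥ ξ` positive, the ray from `ξ₀` would
      -- reach the value `w + 1`.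
      · obtain ⟨ξ₀, hξ₀⟩ := hne
        by_contra hpos
        simp only [mul_zero, sub_zero, not_le] at hpos hC
        have hmem : ∀ s : ℝ, 0 ≤ s → ξ₀ + s • ξ ∈ polyhedron C d := fun s hs j => by
          change C j ⬝ᵥ (ξ₀ + s • ξ) ≤ d j
          rw [dotProduct_add, dotProduct_smul, smul_eq_mul]
          have h1 : C j ⬝ᵥ ξ₀ ≤ d j := hξ₀ j
          have := mul_nonpos_of_nonneg_of_nonpos hs (hC j)
          linarith
        have h0 := h _ (hmem 0 le_rfl)
        have hs : 0 ≤ (w - c ⬝ᵥ ξ₀ + 1) / (c ⬝ᵥ ξ) := by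
          apply div_nonneg _ hpos.le
          simp only [zero_smul, add_zero] at h0
          linarith
        have h1 := h _ (hmem _ hs)
        rw [dotProduct_add, dotProduct_smul, smul_eq_mul, div_mul_cancel₀ _ hpos.ne'] at h1
        linarith
      · have hmem : t⁻¹ • ξ ∈ polyhedron C d := fun j => by
          change C j ⬝ᵥ (t⁻¹ • ξ) ≤ d j
          rw [dotProduct_smul, smul_eq_mul, inv_mul_le_iff₀ ht, mul_comm]
          exact hC j
        have := h _ hmem
        rw [dotProduct_smul, smul_eq_mul, inv_mul_le_iff₀ ht] at this
        linarith)
  have hcu' : ∀ ξ t, c ⬝ᵥ ξ - w * t =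
      u none * -t + ∑ j, u (some j) * (C j ⬝ᵥ ξ - d j * t) := fun ξ t => by
    have := congrArg (fun l : ((Fin m → ℝ) × ℝ) →ₗ[ℝ] ℝ => l (ξ, t)) hcu
    simpa [Fintype.sum_option, hF, LinearMap.sum_apply] using this
  refine ⟨fun j => u (some j), fun j => hu _, ?_, ?_⟩
  · refine dotProduct_eq _ _ fun ξ => ?_
    have := hcu' ξ 0
    simp only [mul_zero, neg_zero, sub_zero, zero_add] at this
    rw [this, mulVec_transpose, ← dotProduct_mulVec]
    rfl
  · have := hcu' 0 1
    simp only [dotProduct_zero, mul_one, zero_sub, mul_neg, Finset.sum_neg_distrib] at this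
    have h0 := hu none
    have : d ⬝ᵥ (fun j => u (some j)) = ∑ j, u (some j) * d j := by
      simp only [dotProduct, mul_comm]
    linarith

/-! ### Polytopes as convex hulls of finite sets -/

/-- A set defined by finitely many linear inequalities has finitely many extreme points. -/
theorem finite_extremePoints_of_finite_inequalities {E : Type*} [AddCommGroup E] [Module ℝ E]
    {T : Set ((E →ₗ[ℝ] ℝ) × ℝ)} (hT : T.Finite) :
    (Set.extremePoints ℝ {z : E | ∀ p ∈ T, p.1 z ≤ p.2}).Finite := by
  refine Set.Finite.of_injOn (f := fun z => {p ∈ T | p.1 z = p.2}) (t := 𝒫 T)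
    (fun z _ => Set.sep_subset _ _) ?_ hT.powerset
  intro x hx y hy hxy
  -- An extreme point is determined by its active constraints: if `x` and `y` share them, `x` can be
  -- moved slightly away from `y`, which puts `x` inside a feasible segment starting at `y`.
  have hev : ∀ᶠ ε in nhdsWithin (0 : ℝ) (Set.Ioi 0), ∀ p ∈ T, p.1 (x + ε • (x - y)) ≤ p.2 := by
    refine (Filter.eventually_all_finite hT).2 fun p hp => ?_
    by_cases hpx : p.1 x = p.2
    · have hpy : p ∈ {p ∈ T | p.1 y = p.2} := by
        have : p ∈ {p ∈ T | p.1 x = p.2} := ⟨hp, hpx⟩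
        simpa only [hxy] using this
      refine Filter.Eventually.of_forall fun ε => ?_
      simp [hpx, hpy.2]
    · have hlt : p.1 x < p.2 := lt_of_le_of_ne (hx.1 p hp) hpx
      have hcont : Continuous fun ε : ℝ => p.1 x + ε * (p.1 x - p.1 y) := by fun_prop
      have := (hcont.tendsto 0).eventually_lt_const (u := p.2) (by simpa using hlt)
      filter_upwards [nhdsWithin_le_nhds this] with ε hε
      simpa using hε.le
  obtain ⟨ε, hε, hpos⟩ := (hev.and self_mem_nhdsWithin).exists
  have hpos : (0 : ℝ) < ε := hpos
  refine (hx.2 hy.1 hε ⟨ε / (1 + ε), 1 / (1 + ε), by positivity, by positivity, ?_, ?_⟩).symm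
  · field_simp
    ring
  · rw [smul_add, smul_smul, ← sub_eq_zero]
    have : (1 / (1 + ε) * ε) = ε / (1 + ε) := by ring
    rw [this, smul_sub, add_comm, add_assoc, sub_add_cancel, ← add_smul, ← sub_eq_zero]
    have : 1 / (1 + ε) + ε / (1 + ε) = 1 := by field_simp
    rw [this, one_smul, sub_self, sub_zero]

/-- A compact set defined by finitely many linear inequalities is the convex hull of a finite
set. -/
theorem exists_finite_convexHull_eq {E : Type*} [NormedAddCommGroup E] [NormedSpace ℝ E]
    {T : Set ((E →ₗ[ℝ] ℝ) × ℝ)} (hT : T.Finite)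
    (hcomp : IsCompact {z : E | ∀ p ∈ T, p.1 z ≤ p.2}) :
    ∃ F : Set E, F.Finite ∧ convexHull ℝ F = {z : E | ∀ p ∈ T, p.1 z ≤ p.2} := by
  have hfin := finite_extremePoints_of_finite_inequalities hT
  refine ⟨_, hfin, ?_⟩
  have hconv : Convex ℝ {z : E | ∀ p ∈ T, p.1 z ≤ p.2} := by
    intro x hx y hy a b ha hb hab p hp
    simp only [map_add, map_smul, smul_eq_mul]
    have h1 := mul_le_mul_of_nonneg_left (hx p hp) ha
    have h2 := mul_le_mul_of_nonneg_left (hy p hp) hb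
    calc _ ≤ a * p.2 + b * p.2 := add_le_add h1 h2
      _ = p.2 := by rw [← add_mul, hab, one_mul]
  -- Krein–Milman; the hull of a finite set is already closed.
  rw [← (hfin.isClosed_convexHull ℝ).closure_eq, closure_convexHull_extremePoints hcomp hconv]

/-! ### The worst-case objective and its finitely many linear pieces -/

/-- Boundedness of `U` makes the real supremum genuine; on a range unbounded above, `⨆` takes the
default value 0. -/
theorem dotProduct_le_worstCase {n m : ℕ} {X : Set (Fin n → ℝ)} {U : Set (Fin m → ℝ)}
    (hU : Bornology.IsBounded U) {f : Fin 2 → (Fin n → ℝ) → (Fin m → ℝ) → ℝ}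
    {c : Fin 2 → (Fin n → ℝ) → Fin m → ℝ}
    (hc : ∀ i, ∀ x ∈ X, ∀ ξ ∈ U, f i x ξ = c i x ⬝ᵥ ξ) {x : Fin n → ℝ} (hx : x ∈ X) (i : Fin 2)
    {ξ : Fin m → ℝ} (hξ : ξ ∈ U) : c i x ⬝ᵥ ξ ≤ worstCase f U x i := by
  have hcont : Continuous fun ξ : Fin m → ℝ => c i x ⬝ᵥ ξ := by
    unfold dotProduct
    fun_prop
  obtain ⟨M, hM⟩ := (hU.isCompact_closure.image hcont).bddAbove
  have hbdd : BddAbove (Set.range fun ξ : U => f i x ξ) := by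
    refine ⟨M, ?_⟩
    rintro _ ⟨ξ, rfl⟩
    change f i x ξ ≤ M
    rw [hc i x hx ξ ξ.2]
    exact hM ⟨ξ, subset_closure ξ.2, rfl⟩
  rw [← hc i x hx ξ hξ]
  exact le_ciSup hbdd ⟨ξ, hξ⟩

theorem worstCase_le {n m : ℕ} {X : Set (Fin n → ℝ)} {U : Set (Fin m → ℝ)} (hU : U.Nonempty)
    {f : Fin 2 → (Fin n → ℝ) → (Fin m → ℝ) → ℝ} {c : Fin 2 → (Fin n → ℝ) → Fin m → ℝ}
    (hc : ∀ i, ∀ x ∈ X, ∀ ξ ∈ U, f i x ξ = c i x ⬝ᵥ ξ) {x : Fin n → ℝ} (hx : x ∈ X) {i : Fin 2}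
    {v : ℝ} (h : ∀ ξ ∈ U, c i x ⬝ᵥ ξ ≤ v) : worstCase f U x i ≤ v := by
  have : Nonempty U := hU.to_subtype
  refine ciSup_le fun ξ => ?_
  rw [hc i x hx ξ ξ.2]
  exact h ξ ξ.2

theorem isClosed_finite_inequalities {n : ℕ} (T : Set (((Fin n → ℝ) →ₗ[ℝ] ℝ) × ℝ)) :
    IsClosed {z : Fin n → ℝ | ∀ p ∈ T, p.1 z ≤ p.2} := by
  simp only [Set.ofPred_forall]
  refine isClosed_iInter fun p => isClosed_iInter fun _ => ?_
  exact isClosed_le p.1.continuous_of_finiteDimensional continuous_const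

/-- The inequalities that define a polyhedron. -/
def polyhedronInequalities {r n : ℕ} (M : Matrix (Fin r) (Fin n) ℝ) (v : Fin r → ℝ) :
    Set (((Fin n → ℝ) →ₗ[ℝ] ℝ) × ℝ) :=
  Set.range fun j => (dotProductBilin ℝ ℝ (M j), v j)

theorem mem_polyhedron_iff {r n : ℕ} (M : Matrix (Fin r) (Fin n) ℝ) (v : Fin r → ℝ)
    (z : Fin n → ℝ) : z ∈ polyhedron M v ↔ ∀ p ∈ polyhedronInequalities M v, p.1 z ≤ p.2 := by
  simp only [polyhedronInequalities, Set.forall_mem_range]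
  rfl

/-- A bounded polyhedron is the convex hull of a finite set. -/
theorem exists_finite_convexHull_eq_polyhedron {r n : ℕ} (M : Matrix (Fin r) (Fin n) ℝ)
    (v : Fin r → ℝ) (hb : Bornology.IsBounded (polyhedron M v)) :
    ∃ F : Set (Fin n → ℝ), F.Finite ∧ convexHull ℝ F = polyhedron M v := by
  have heq : polyhedron M v = {z | ∀ p ∈ polyhedronInequalities M v, p.1 z ≤ p.2} :=
    Set.ext (mem_polyhedron_iff M v)
  have hcl := isClosed_finite_inequalities (polyhedronInequalities M v)
  rw [heq] at hb ⊢
  exact exists_finite_convexHull_eq (Set.finite_range _) (Metric.isCompact_of_isClosed_isBounded hcl hb)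

/-- A linear functional attains its maximum over the convex hull of a finite set at one of the
points. -/
theorem exists_max_of_finite_convexHull {m : ℕ} {F : Set (Fin m → ℝ)} (hF : F.Finite)
    (hne : F.Nonempty) (v : Fin m → ℝ) :
    ∃ ξ ∈ F, ∀ ξ' ∈ convexHull ℝ F, v ⬝ᵥ ξ' ≤ v ⬝ᵥ ξ := by
  obtain ⟨ξ, hξ, hmax⟩ := Set.exists_max_image F (fun ξ => v ⬝ᵥ ξ) hF hne
  have hconv : Convex ℝ {ξ' | v ⬝ᵥ ξ' ≤ v ⬝ᵥ ξ} :=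
    convex_halfSpace_le (f := fun ξ' => v ⬝ᵥ ξ')
      ⟨fun a b => dotProduct_add _ _ _, fun a b => dotProduct_smul _ _ _⟩ _
  exact ⟨ξ, hξ, fun ξ' hξ' => convexHull_min (s := F) hmax hconv hξ'⟩

/-- The image of the feasible set under the worst-case objective is contained in the convex hull of
finitely many of its points. -/
theorem exists_finite_subset_image_worstCase {n m r q k : ℕ}
    (A : Matrix (Fin r) (Fin n) ℝ) (b : Fin r → ℝ)
    (X : Set (Fin n → ℝ)) (hX : X = mixedIntegerPart k (polyhedron A b))
    (hP : Bornology.IsBounded (polyhedron A b))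
    (C : Matrix (Fin q) (Fin m) ℝ) (d : Fin q → ℝ)
    (U : Set (Fin m → ℝ)) (hU : U = polyhedron C d)
    (hUb : Bornology.IsBounded U) (hUne : U.Nonempty)
    (f : Fin 2 → (Fin n → ℝ) → (Fin m → ℝ) → ℝ)
    (hf : ∀ i, IsBilinearOn X U (f i))
    (c : Fin 2 → (Fin n → ℝ) → Fin m → ℝ)
    (hc : ∀ i, ∀ x ∈ X, ∀ ξ ∈ U, f i x ξ = c i x ⬝ᵥ ξ) :
    ∃ V : Set (Fin 2 → ℝ), V.Finite ∧ V ⊆ worstCase f U '' X ∧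
      worstCase f U '' X ⊆ convexHull ℝ V := by
  obtain ⟨E, hEfin, hE⟩ := exists_finite_convexHull_eq_polyhedron C d (hU ▸ hUb)
  rw [← hU] at hE
  have hEU : E ⊆ U := hE ▸ subset_convexHull ℝ E
  have hEne : E.Nonempty := by
    rw [← convexHull_nonempty_iff (𝕜 := ℝ), hE]
    exact hUne
  have hl : ∀ i ξ, ∃ l : (Fin n → ℝ) →ₗ[ℝ] ℝ, ξ ∈ U → ∀ x ∈ X, f i x ξ = l x := fun i ξ => by
    by_cases hξ : ξ ∈ U
    · obtain ⟨l, hl⟩ := (hf i).1 ξ hξ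
      exact ⟨l, fun _ => hl⟩
    · exact ⟨0, fun h => absurd h hξ⟩
  choose l hl using hl
  have hlc : ∀ i, ∀ ξ ∈ U, ∀ x ∈ X, l i ξ x = c i x ⬝ᵥ ξ := fun i ξ hξ x hx => by
    rw [← hl i ξ hξ x hx, hc i x hx ξ hξ]
  -- the cells on which the integer variables are fixed and the objective is linear
  let T : (Fin n → ℤ) → (Fin 2 → Fin m → ℝ) → Set (((Fin n → ℝ) →ₗ[ℝ] ℝ) × ℝ) := fun z e =>
    polyhedronInequalities A b ∪
      ((fun i => (LinearMap.proj i, (z i : ℝ))) '' {i : Fin n | (i : ℕ) < k} ∪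
        (fun i => (-LinearMap.proj i, -(z i : ℝ))) '' {i : Fin n | (i : ℕ) < k}) ∪
      ⋃ i, (fun ξ => (l i ξ - l i (e i), 0)) '' E
  have hTfin : ∀ z e, (T z e).Finite := fun z e =>
    ((Set.finite_range _).union ((Set.toFinite _).union (Set.toFinite _))).union
      (Set.finite_iUnion fun i => hEfin.image _)
  have hmem : ∀ z e x, (∀ p ∈ T z e, p.1 x ≤ p.2) ↔ x ∈ polyhedron A b ∧
      (∀ i : Fin n, (i : ℕ) < k → x i = z i) ∧ ∀ i, ∀ ξ ∈ E, l i ξ x ≤ l i (e i) x := by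
    intro z e x
    simp only [T, Set.union_def, Set.mem_ofPred_eq, or_imp, forall_and, ← mem_polyhedron_iff,
      Set.forall_mem_image, Set.mem_iUnion, forall_exists_index, and_assoc]
    refine and_congr Iff.rfl ?_
    rw [← and_assoc, ← forall_and]
    refine and_congr ?_ ?_
    · refine forall_congr' fun i => ?_
      rw [← forall_and]
      refine forall_congr' fun hi => ?_
      simp [le_antisymm_iff]
    · constructor
      · intro h i ξ hξ
        have := h _ i ⟨ξ, hξ, rfl⟩
        simpa using this
      · rintro h p i ⟨ξ, hξ, rfl⟩
        simpa using h i ξ hξ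
  have hcell : ∀ z e, ∃ F : Set (Fin n → ℝ), F.Finite ∧
      convexHull ℝ F = {x | ∀ p ∈ T z e, p.1 x ≤ p.2} := fun z e => by
    refine exists_finite_convexHull_eq (hTfin z e)
      (Metric.isCompact_of_isClosed_isBounded (isClosed_finite_inequalities _) ?_)
    exact hP.subset fun x hx => ((hmem z e x).1 hx).1
  choose F hFfin hF using hcell
  have hTX : ∀ z e x, (∀ p ∈ T z e, p.1 x ≤ p.2) → x ∈ X := fun z e x hx => by
    rw [hmem] at hx
    rw [hX]
    exact ⟨hx.1, fun i hi => ⟨z i, hx.2.1 i hi⟩⟩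
  have hFX : ∀ z e, F z e ⊆ X := fun z e x hx =>
    hTX z e x ((hF z e).subset (subset_convexHull ℝ _ hx))
  -- On the cell `(z, e)` the scenario `e i` is worst among the points of `E`, hence worst on their
  -- hull `U`, so the objective is linear there.
  have hval : ∀ z e, (∀ i, e i ∈ E) → ∀ x, (∀ p ∈ T z e, p.1 x ≤ p.2) →
      worstCase f U x = LinearMap.pi (fun i => l i (e i)) x := fun z e he x hx => by
    have hxX := hTX z e x hx
    rw [hmem] at hx
    funext i
    rw [LinearMap.pi_apply, hlc i _ (hEU (he i)) x hxX]
    refine le_antisymm (worstCase_le hUne hc hxX ?_)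
      (dotProduct_le_worstCase hUb hc hxX i (hEU (he i)))
    obtain ⟨ξ, hξ, hmax⟩ := exists_max_of_finite_convexHull hEfin hEne (c i x)
    intro ξ' hξ'
    refine (hmax ξ' (hE ▸ hξ')).trans ?_
    rw [← hlc i _ (hEU hξ) x hxX, ← hlc i _ (hEU (he i)) x hxX]
    exact hx.2.2 i ξ hξ
  obtain ⟨R, hR⟩ := hP.exists_norm_le
  obtain ⟨N, hN⟩ := exists_nat_ge R
  let I : Set ((Fin n → ℤ) × (Fin 2 → Fin m → ℝ)) :=
    Set.Icc (fun _ => -(N : ℤ)) (fun _ => (N : ℤ)) ×ˢ Set.pi Set.univ fun _ => E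
  have hI : I.Finite := (Set.finite_Icc _ _).prod (Set.Finite.pi fun _ => hEfin)
  refine ⟨⋃ s ∈ I, worstCase f U '' F s.1 s.2, hI.biUnion fun s _ => (hFfin _ _).image _,
    Set.iUnion₂_subset fun s _ => Set.image_mono (hFX _ _), ?_⟩
  rintro _ ⟨x, hx, rfl⟩
  have hx' := hx
  rw [hX] at hx'
  have hz : ∀ i : Fin n, ∃ z : ℤ, -(N : ℤ) ≤ z ∧ z ≤ N ∧ ((i : ℕ) < k → x i = z) := fun i => by
    by_cases hi : (i : ℕ) < k
    · obtain ⟨z, hz⟩ := hx'.2 i hi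
      have h1 : |x i| ≤ N := ((norm_le_pi_norm x i).trans (hR x hx'.1)).trans hN
      rw [hz, abs_le] at h1
      exact ⟨z, by exact_mod_cast h1.1, by exact_mod_cast h1.2, fun _ => hz⟩
    -- The cells do not constrain continuous coordinates through `z`; the value 0 keeps `z` in the
    -- finite box.
    · exact ⟨0, by simp, by simp, fun h => absurd h hi⟩
  choose z hz1 hz2 hz3 using hz
  have he : ∀ i, ∃ ξ ∈ E, ∀ ξ' ∈ convexHull ℝ E, c i x ⬝ᵥ ξ' ≤ c i x ⬝ᵥ ξ := fun i =>
    exists_max_of_finite_convexHull hEfin hEne (c i x)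
  choose e heE he using he
  have hxT : ∀ p ∈ T z e, p.1 x ≤ p.2 := by
    rw [hmem]
    refine ⟨hx'.1, hz3, fun i ξ hξ => ?_⟩
    rw [hlc i ξ (hEU hξ) x hx, hlc i _ (hEU (heE i)) x hx]
    exact he i ξ (subset_convexHull ℝ E hξ)
  have hsI : (z, e) ∈ I := ⟨⟨hz1, hz2⟩, fun i _ => heE i⟩
  refine convexHull_mono (Set.subset_biUnion_of_mem hsI) ?_
  have himg : worstCase f U '' F z e = LinearMap.pi (fun i => l i (e i)) '' F z e :=
    Set.image_congr fun y hy =>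
      hval z e heE y ((hF z e).subset (subset_convexHull ℝ _ hy))
  change worstCase f U x ∈ convexHull ℝ (worstCase f U '' F z e)
  -- A linear map sends the hull of the generators of the cell to the hull of their images.
  rw [himg, ← LinearMap.image_convexHull, hF z e, hval z e heE x hxT]
  exact ⟨x, hxT, rfl⟩

/-! ### Worst-case vectors as least dual points -/

theorem dualObjective_eq {q : ℕ} (d : Fin q → ℝ) (lam : Fin 2 → ℝ) (p : Fin 2 → Fin q → ℝ) :
    DA.dualObjective d lam p = lam ⬝ᵥ DA.dualPoint d p := by
  simp only [DA.dualObjective, dotProduct_sum, dotProduct_smul, smul_eq_mul]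
  rfl

/-- The value `w x` is the componentwise minimum of the dual points of `x`. -/
def IsDualValue {n m q : ℕ} (X : Set (Fin n → ℝ)) (C : Matrix (Fin q) (Fin m) ℝ) (d : Fin q → ℝ)
    (c : Fin 2 → (Fin n → ℝ) → Fin m → ℝ) (w : (Fin n → ℝ) → Fin 2 → ℝ) : Prop :=
  ∀ x ∈ X, IsLeast (DA.dualPoint d '' DA.dualFeasible C c x) (w x)

/-- Weak duality gives the lower bound. Strong duality applied to each objective separately gives a
pair of dual vectors attaining both components at once. -/
theorem isDualValue_worstCase {n m q : ℕ} {X : Set (Fin n → ℝ)} {C : Matrix (Fin q) (Fin m) ℝ}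
    {d : Fin q → ℝ} {f : Fin 2 → (Fin n → ℝ) → (Fin m → ℝ) → ℝ}
    {c : Fin 2 → (Fin n → ℝ) → Fin m → ℝ} (hne : (polyhedron C d).Nonempty)
    (hb : Bornology.IsBounded (polyhedron C d))
    (hc : ∀ i, ∀ x ∈ X, ∀ ξ ∈ polyhedron C d, f i x ξ = c i x ⬝ᵥ ξ) :
    IsDualValue X C d c (worstCase f (polyhedron C d)) := by
  intro x hx
  have hweak : ∀ p ∈ DA.dualFeasible C c x,
      worstCase f (polyhedron C d) x ≤ DA.dualPoint d p := fun p hp i => by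
    refine worstCase_le hne hc hx fun ξ hξ => ?_
    rw [← (hp i).1, mulVec_transpose, ← dotProduct_mulVec, dotProduct_comm]
    exact dotProduct_le_dotProduct_of_nonneg_right hξ (hp i).2
  refine ⟨?_, Set.forall_mem_image.2 hweak⟩
  have := fun i => exists_dual_of_le_on_polyhedron C d hne (c i x)
    (worstCase f (polyhedron C d) x i) fun ξ hξ => dotProduct_le_worstCase hb hc hx i hξ
  choose p hp0 hpc hpd using this
  have hp : p ∈ DA.dualFeasible C c x := fun i => ⟨hpc i, hp0 i⟩
  exact ⟨p, hp, le_antisymm hpd (hweak p hp)⟩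

/-! ### Linear and lexicographic bounds on convex hulls -/

section convexity

variable {E : Type*} [AddCommGroup E] [Module ℝ E]

theorem le_of_mem_convexHull {V : Set E} {g : E →ₗ[ℝ] ℝ} {a : ℝ} (h : ∀ v ∈ V, a ≤ g v) {z : E}
    (hz : z ∈ convexHull ℝ V) : a ≤ g z :=
  convexHull_min h (convex_halfSpace_ge g.isLinear a) hz

/-- Strict lower bounds with respect to the lexicographic order given by two linear functionals
carry over to convex hulls. -/
theorem lex_lt_of_mem_convexHull {V : Set E} {g h : E →ₗ[ℝ] ℝ} {a b : ℝ}
    (hV : ∀ v ∈ V, a ≤ g v ∧ (g v ≤ a → b < h v)) {z : E} (hz : z ∈ convexHull ℝ V) :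
    a ≤ g z ∧ (g z ≤ a → b < h z) := by
  refine convexHull_min (t := {z | a ≤ g z ∧ (g z ≤ a → b < h z)}) hV ?_ hz
  rw [convex_iff_forall_pos]
  rintro x ⟨hx1, hx2⟩ y ⟨hy1, hy2⟩ s t hs ht hst
  have hsx := mul_le_mul_of_nonneg_left hx1 hs.le
  have hty := mul_le_mul_of_nonneg_left hy1 ht.le
  have hab : ∀ r : ℝ, r = s * r + t * r := fun r => by rw [← add_mul, hst, one_mul]
  have ha := hab a
  have hb := hab b
  simp only [Set.mem_ofPred_eq, map_add, map_smul, smul_eq_mul]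
  -- Since both weights are positive, a combination with `g`-value at most `a` forces `g x ≤ a` and
  -- `g y ≤ a`, so both strict bounds apply.
  refine ⟨by linarith, fun hle => ?_⟩
  have h1 := mul_lt_mul_of_pos_left (hx2 (le_of_mul_le_mul_left (by linarith) hs)) hs
  have h2 := mul_lt_mul_of_pos_left (hy2 (le_of_mul_le_mul_left (by linarith) ht)) ht
  linarith

/-- Over a set contained in the convex hull of a finite set, two linear functionals can be
minimized lexicographically. -/
theorem exists_lex_min {V Y : Set E} (hV : V.Finite) (hY : Y ⊆ convexHull ℝ V) (hne : Y.Nonempty)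
    (g h : E →ₗ[ℝ] ℝ) :
    ∃ v ∈ V, (∀ y ∈ Y, g v ≤ g y) ∧ ∀ y ∈ Y, g y ≤ g v → h v ≤ h y := by
  have hVne : V.Nonempty := (convexHull_nonempty_iff (𝕜 := ℝ)).1 (hne.mono hY)
  obtain ⟨v₀, hv₀, hmin₀⟩ := Set.exists_min_image V g hV hVne
  obtain ⟨v, ⟨hv, hgv⟩, hmin⟩ := Set.exists_min_image {v ∈ V | g v = g v₀} h
    (hV.subset (Set.sep_subset _ _)) ⟨v₀, hv₀, rfl⟩
  refine ⟨v, hv, fun y hy => hgv ▸ le_of_mem_convexHull hmin₀ (hY hy), fun y hy hle => ?_⟩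
  -- If `h y < h v`, every point of `V` satisfies the lexicographic bound with `b = h y`; so does
  -- `y` in its hull, giving `h y < h y`.
  by_contra hlt
  rw [not_le] at hlt
  refine lt_irrefl _ ((lex_lt_of_mem_convexHull (g := g) (h := h) (a := g v₀) (b := h y)
    (fun u hu => ⟨hmin₀ u hu, fun hu' => ?_⟩) (hY hy)).2 (hgv ▸ hle))
  exact hlt.trans_le (hmin u ⟨hu, le_antisymm hu' (hmin₀ u hu)⟩)

end convexity

/-! ### Hull-minimal points in the plane -/

/-- The linear functional `z ↦ lam ⬝ᵥ z`. -/
abbrev dotLin (lam : Fin 2 → ℝ) : (Fin 2 → ℝ) →ₗ[ℝ] ℝ := dotProductBilin ℝ ℝ lam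

theorem dotLin_apply (lam z : Fin 2 → ℝ) : dotLin lam z = lam 0 * z 0 + lam 1 * z 1 := by
  change lam ⬝ᵥ z = _
  simp [dotProduct, Fin.sum_univ_two]

/-- A point of `Y` that is nondominated in the convex hull of `Y`. -/
def IsHullMinimal (Y : Set (Fin 2 → ℝ)) (y : Fin 2 → ℝ) : Prop :=
  y ∈ Y ∧ ∀ z ∈ convexHull ℝ Y, z ≤ y → z = y

namespace IsHullMinimal

variable {Y : Set (Fin 2 → ℝ)} {y y' : Fin 2 → ℝ}

theorem of_weight {lam : Fin 2 → ℝ} (hlam : ∀ i, 0 < lam i) (hy : y ∈ Y)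
    (hmin : ∀ y' ∈ Y, dotLin lam y ≤ dotLin lam y') : IsHullMinimal Y y := by
  refine ⟨hy, fun z hz hzy => ?_⟩
  have h := le_of_mem_convexHull hmin hz
  rw [dotLin_apply, dotLin_apply] at h
  have h0 := mul_le_mul_of_nonneg_left (hzy 0) (hlam 0).le
  have h1 := mul_le_mul_of_nonneg_left (hzy 1) (hlam 1).le
  refine le_antisymm hzy (Fin.forall_fin_two.2 ⟨?_, ?_⟩)
  · exact le_of_mul_le_mul_left (by linarith) (hlam 0)
  · exact le_of_mul_le_mul_left (by linarith) (hlam 1)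

/-- Replaces `of_weight` for the two initial points, whose weight vectors have a zero entry: the
lexicographic tie-break controls the coordinate of weight 0. -/
theorem of_lex {i j : Fin 2} (hij : i ≠ j) (hy : y ∈ Y) (hi : ∀ y' ∈ Y, y i ≤ y' i)
    (hj : ∀ y' ∈ Y, y' i ≤ y i → y j ≤ y' j) : IsHullMinimal Y y := by
  refine ⟨hy, fun z hz hzy => ?_⟩
  have h1 : y i ≤ z i := le_of_mem_convexHull (g := LinearMap.proj i) hi hz
  have h2 : y j ≤ z j := by
    by_contra hlt
    rw [not_le] at hlt
    exact lt_irrefl _ ((lex_lt_of_mem_convexHull (g := LinearMap.proj i) (h := LinearMap.proj j)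
      (a := y i) (b := z j) (fun u hu => ⟨hi u hu, fun hu' => hlt.trans_le (hj u hu hu')⟩) hz).2
      (hzy i))
  refine le_antisymm hzy fun l => ?_
  have : l = i ∨ l = j := by omega
  rcases this with rfl | rfl
  exacts [h1, h2]

theorem eq_of_le (hy : IsHullMinimal Y y) (hy' : y' ∈ Y) (h : y' ≤ y) : y' = y :=
  hy.2 y' (subset_convexHull ℝ _ hy') h

theorem mem_nondominatedPoints (hy : IsHullMinimal Y y) : y ∈ nondominatedPoints Y :=
  ⟨hy.1, fun ⟨_, hy', h⟩ => h.2 (hy.eq_of_le hy' h.1)⟩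

theorem mem_supportedPoints (hy : IsHullMinimal Y y) : y ∈ supportedPoints Y := by
  refine ⟨hy.mem_nondominatedPoints, fun ⟨z, hz, hlt⟩ => ?_⟩
  have hz' : z ∈ convexHull ℝ Y := convexHull_mono (fun u hu => hu.1.1) hz
  have := hy.2 z hz' fun i => (hlt i).le
  exact lt_irrefl _ (this ▸ hlt 0)

theorem eq_of_zero_eq (hy : IsHullMinimal Y y) (hy' : IsHullMinimal Y y') (h : y 0 = y' 0) :
    y = y' := by
  rcases le_total (y 1) (y' 1) with h1 | h1
  · exact hy'.eq_of_le hy.1 (Fin.forall_fin_two.2 ⟨h.le, h1⟩)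
  · exact (hy.eq_of_le hy'.1 (Fin.forall_fin_two.2 ⟨h.ge, h1⟩)).symm

theorem one_lt (hy : IsHullMinimal Y y) (hy' : IsHullMinimal Y y') (h : y 0 < y' 0) :
    y' 1 < y 1 := by
  by_contra hle
  rw [not_lt] at hle
  have := hy'.eq_of_le hy.1 (Fin.forall_fin_two.2 ⟨h.le, hle⟩)
  exact h.ne (congrFun this 0)

/-- No segment of the convex hull passes below a hull-minimal point. -/
theorem not_segment_below {lam p q : Fin 2 → ℝ} (hy : IsHullMinimal Y y) (hlam : 0 < lam 1)
    (hp : p ∈ convexHull ℝ Y) (hq : q ∈ convexHull ℝ Y)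
    (hpq : (p 0 ≤ y 0 ∧ y 0 < q 0) ∨ (q 0 < y 0 ∧ y 0 ≤ p 0))
    (hlp : dotLin lam p < dotLin lam y) (hlq : dotLin lam q ≤ dotLin lam y) : False := by
  -- The point of the segment above abscissa `y 0`. As `p` has positive weight `s`, its value is
  -- strictly below that of `y`, hence so is its second coordinate, contradicting minimality.
  obtain ⟨s, t, hs, ht, hst, hy0⟩ :
      ∃ s t : ℝ, 0 < s ∧ 0 ≤ t ∧ s + t = 1 ∧ s * p 0 + t * q 0 = y 0 := by
    rcases hpq with ⟨h1, h2⟩ | ⟨h1, h2⟩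
    · have h : 0 < q 0 - p 0 := by linarith
      refine ⟨(q 0 - y 0) / (q 0 - p 0), (y 0 - p 0) / (q 0 - p 0), div_pos (by linarith) h,
        div_nonneg (by linarith) h.le, ?_, ?_⟩ <;> field_simp <;> ring
    · have h : 0 < p 0 - q 0 := by linarith
      refine ⟨(y 0 - q 0) / (p 0 - q 0), (p 0 - y 0) / (p 0 - q 0), div_pos (by linarith) h,
        div_nonneg (by linarith) h.le, ?_, ?_⟩ <;> field_simp <;> ring
  have hz : s • p + t • q ∈ convexHull ℝ Y := convex_convexHull ℝ Y hp hq hs.le ht hst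
  have hlz : dotLin lam (s • p + t • q) < dotLin lam y := by
    rw [map_add, map_smul, map_smul, smul_eq_mul, smul_eq_mul]
    have h1 := mul_lt_mul_of_pos_left hlp hs
    have h2 := mul_le_mul_of_nonneg_left hlq ht
    calc _ < s * dotLin lam y + t * dotLin lam y := add_lt_add_of_lt_of_le h1 h2
      _ = _ := by rw [← add_mul, hst, one_mul]
  have hz0 : (s • p + t • q) 0 = y 0 := by simpa using hy0
  have hle : (s • p + t • q) ≤ y := by
    refine Fin.forall_fin_two.2 ⟨hz0.le, ?_⟩
    · rw [dotLin_apply, dotLin_apply, hz0] at hlz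
      exact (lt_of_mul_lt_mul_left (by linarith) hlam.le).le
  rw [hy.2 _ hz hle] at hlz
  exact lt_irrefl _ hlz

theorem weight_pos (hy : IsHullMinimal Y y) (hy' : IsHullMinimal Y y') (h : y 0 < y' 0) (i : Fin 2) :
    0 < DA.weight y y' i := by
  have := hy.one_lt hy' h
  fin_cases i
  · exact sub_pos.2 this
  · exact sub_pos.2 h

/-- A point of the convex hull below the line through two hull-minimal points lies strictly
between them. -/
theorem between_of_below {v : Fin 2 → ℝ} (hy : IsHullMinimal Y y) (hy' : IsHullMinimal Y y')
    (h : y 0 < y' 0) (hv : v ∈ convexHull ℝ Y)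
    (hlt : dotLin (DA.weight y y') v < dotLin (DA.weight y y') y) : y 0 < v 0 ∧ v 0 < y' 0 := by
  have heq : dotLin (DA.weight y y') y' = dotLin (DA.weight y y') y := by
    simp only [dotLin_apply, DA.weight, cons_val_zero, cons_val_one]
    ring
  have hpos := hy.weight_pos hy' h 1
  have hmem : ∀ {u}, IsHullMinimal Y u → u ∈ convexHull ℝ Y := fun hu =>
    subset_convexHull ℝ Y hu.1
  -- If `v` were not to the right of `y`, the segment from `v` to `y'` would pass below `y`;
  -- symmetrically at `y'`.
  constructor
  · by_contra hle
    exact hy.not_segment_below hpos hv (hmem hy') (Or.inl ⟨not_lt.1 hle, h⟩) hlt heq.le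
  · by_contra hle
    exact hy'.not_segment_below hpos hv (hmem hy) (Or.inr ⟨h, not_lt.1 hle⟩) (heq ▸ hlt) heq.ge

/-- A pair whose connecting line supports `Y` has no extreme supported point strictly between. -/
theorem not_extreme_between {u : Fin 2 → ℝ} (hy : IsHullMinimal Y y) (hy' : IsHullMinimal Y y')
    (hmin : ∀ z ∈ Y, dotLin (DA.weight y y') y ≤ dotLin (DA.weight y y') z)
    (hu : u ∈ extremeSupportedPoints Y) (h1 : y 0 < u 0) (h2 : u 0 < y' 0) : False := by
  have h : y 0 < y' 0 := h1.trans h2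
  have hlu := hmin u hu.1
  have hd : 0 < y' 0 - y 0 := sub_pos.2 h
  have hmem : ∀ {v}, IsHullMinimal Y v → v 0 ≠ u 0 →
      v ∈ convexHull ℝ (nondominatedPoints Y \ {u}) := fun hv hne =>
    subset_convexHull ℝ _ ⟨hv.mem_nondominatedPoints, fun h => hne (congrFun h 0)⟩
  -- The point of the segment from `y` to `y'` with first coordinate `u 0`; since `u` is not below
  -- the line, this point is at most `u`.
  refine hu.2 ⟨((y' 0 - u 0) / (y' 0 - y 0)) • y + ((u 0 - y 0) / (y' 0 - y 0)) • y',
    convex_convexHull ℝ _ (hmem hy h1.ne) (hmem hy' h2.ne')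
      (div_nonneg (by linarith) hd.le) (div_nonneg (by linarith) hd.le) ?_,
    Fin.forall_fin_two.2 ⟨le_of_eq ?_, ?_⟩⟩
  · field_simp
    ring
  · simp only [Pi.add_apply, Pi.smul_apply, smul_eq_mul]
    field_simp
    ring
  · simp only [dotLin_apply, DA.weight, cons_val_zero, cons_val_one] at hlu
    simp only [Pi.add_apply, Pi.smul_apply, smul_eq_mul]
    rw [div_mul_eq_mul_div, div_mul_eq_mul_div, ← add_div, div_le_iff₀ hd]
    linarith

end IsHullMinimal

/-- Elements of `V` whose first coordinate lies strictly between those of `y` and `y'`. -/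
def pointsBetween (V : Set (Fin 2 → ℝ)) (y y' : Fin 2 → ℝ) : Set (Fin 2 → ℝ) :=
  {v ∈ V | y 0 < v 0 ∧ v 0 < y' 0}

/-- If a weighted-sum minimizer lies below the line through two hull-minimal points, then there are
fewer points of `V` on either side of it than between the two points. -/
theorem ncard_pointsBetween_lt {V Y : Set (Fin 2 → ℝ)} (hV : V.Finite) (hVY : V ⊆ Y)
    (hYV : Y ⊆ convexHull ℝ V) {yl yr y : Fin 2 → ℝ} (hl : IsHullMinimal Y yl)
    (hr : IsHullMinimal Y yr) (hlr : yl 0 < yr 0) (hy : y ∈ Y)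
    (hmin : ∀ z ∈ Y, dotLin (DA.weight yl yr) y ≤ dotLin (DA.weight yl yr) z)
    (hlt : dotLin (DA.weight yl yr) y < dotLin (DA.weight yl yr) yl) :
    (pointsBetween V yl y).ncard < (pointsBetween V yl yr).ncard ∧
      (pointsBetween V y yr).ncard < (pointsBetween V yl yr).ncard := by
  have hfin : (pointsBetween V yl yr).Finite := hV.subset (Set.sep_subset _ _)
  -- The minimizer `y` need not belong to `V`, but it is a convex combination of points of `V` that
  -- are minimizers too and so lie strictly between. One of them has `h`-value at most `h y`; taking
  -- `h` as minus or plus the first coordinate yields a point lost from the left or the right pair.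
  have key : ∀ h : (Fin 2 → ℝ) →ₗ[ℝ] ℝ,
      ∃ v ∈ V, (yl 0 < v 0 ∧ v 0 < yr 0) ∧ h v ≤ h y := fun h => by
    by_contra hcon
    push Not at hcon
    refine lt_irrefl _ ((lex_lt_of_mem_convexHull (g := dotLin (DA.weight yl yr)) (h := h)
      (a := dotLin (DA.weight yl yr) y) (b := h y)
      (fun v hv => ⟨hmin v (hVY hv), fun hle => ?_⟩) (hYV hy)).2 le_rfl)
    exact hcon v hv (hl.between_of_below hr hlr (subset_convexHull ℝ _ (hVY hv)) (hle.trans_lt hlt))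
  have hbt := hl.between_of_below hr hlr (subset_convexHull ℝ _ hy) hlt
  constructor
  · obtain ⟨v, hv, hvb, hvy⟩ := key (-LinearMap.proj 0)
    simp only [LinearMap.neg_apply, LinearMap.proj_apply, neg_le_neg_iff] at hvy
    refine Set.ncard_lt_ncard (Set.ssubset_iff_of_subset ?_ |>.2 ⟨v, ⟨hv, hvb⟩, ?_⟩) hfin
    · exact fun u hu => ⟨hu.1, hu.2.1, hu.2.2.trans hbt.2⟩
    · exact fun hv' => absurd hv'.2.2 (not_lt.2 hvy)
  · obtain ⟨v, hv, hvb, hvy⟩ := key (LinearMap.proj 0)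
    refine Set.ncard_lt_ncard (Set.ssubset_iff_of_subset ?_ |>.2 ⟨v, ⟨hv, hvb⟩, ?_⟩) hfin
    · exact fun u hu => ⟨hu.1, hbt.1.trans hu.2.1, hu.2.2⟩
    · exact fun hv' => absurd hv'.2.1 (not_lt.2 hvy)

/-! ### Optimal solutions of the dual programs and the initialization -/

section optimality

variable {n m q : ℕ} {X : Set (Fin n → ℝ)} {C : Matrix (Fin q) (Fin m) ℝ} {d : Fin q → ℝ}
  {c : Fin 2 → (Fin n → ℝ) → Fin m → ℝ} {w : (Fin n → ℝ) → Fin 2 → ℝ}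

theorem dotLin_mono {lam : Fin 2 → ℝ} (hlam : 0 ≤ lam) : Monotone (dotLin lam) := fun _ _ h =>
  dotProduct_le_dotProduct_of_nonneg_left h hlam

namespace IsDualValue

theorem isLeast_dualObjective (hw : IsDualValue X C d c w) {x : Fin n → ℝ} (hx : x ∈ X)
    {lam : Fin 2 → ℝ} (hlam : 0 ≤ lam) :
    IsLeast (DA.dualObjective d lam '' DA.dualFeasible C c x) (dotLin lam (w x)) := by
  constructor
  · obtain ⟨p, hp, hpw⟩ := (hw x hx).1
    exact ⟨p, hp, by rw [dualObjective_eq, hpw]; rfl⟩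
  · rintro _ ⟨p, hp, rfl⟩
    rw [dualObjective_eq]
    exact dotLin_mono hlam ((hw x hx).2 ⟨p, hp, rfl⟩)

theorem innerValue_eq (hw : IsDualValue X C d c w) {x : Fin n → ℝ} (hx : x ∈ X)
    {lam : Fin 2 → ℝ} (hlam : 0 ≤ lam) : DA.innerValue C d c lam x = dotLin lam (w x) :=
  (hw.isLeast_dualObjective hx hlam).csInf_eq

theorem exists_isOptimal (hw : IsDualValue X C d c w) {x : Fin n → ℝ} (hx : x ∈ X)
    {lam : Fin 2 → ℝ} (hlam : 0 ≤ lam)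
    (hmin : ∀ y ∈ w '' X, dotLin lam (w x) ≤ dotLin lam y) :
    ∃ p, DA.IsOptimal X C d c lam (x, p) ∧ DA.dualPoint d p = w x := by
  obtain ⟨p, hp, hpw⟩ := (hw x hx).1
  refine ⟨p, ⟨⟨hx, hp⟩, ?_⟩, hpw⟩
  rintro ⟨x', p'⟩ ⟨hx', hp'⟩
  rw [dualObjective_eq, hpw]
  exact (hmin _ ⟨x', hx', rfl⟩).trans ((hw.isLeast_dualObjective hx' hlam).2 ⟨p', hp', rfl⟩)

theorem of_isOptimal (hw : IsDualValue X C d c w) {lam : Fin 2 → ℝ} (hlam : 0 ≤ lam)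
    {x : Fin n → ℝ} {p : Fin 2 → Fin q → ℝ} (hopt : DA.IsOptimal X C d c lam (x, p)) :
    DA.dualObjective d lam p = dotLin lam (w x) ∧
      ∀ y ∈ w '' X, dotLin lam (w x) ≤ dotLin lam y := by
  have hx : x ∈ X := hopt.1.1
  have heq : DA.dualObjective d lam p = dotLin lam (w x) := by
    obtain ⟨p', hp', h⟩ := (hw.isLeast_dualObjective hx hlam).1
    exact le_antisymm ((hopt.2 (x, p') ⟨hx, hp'⟩).trans h.le)
      ((hw.isLeast_dualObjective hx hlam).2 ⟨p, hopt.1.2, rfl⟩)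
  refine ⟨heq, ?_⟩
  rintro _ ⟨x', hx', rfl⟩
  obtain ⟨p', hp', h⟩ := (hw.isLeast_dualObjective hx' hlam).1
  rw [← heq, ← h]
  exact hopt.2 (x', p') ⟨hx', hp'⟩

/-- The dual point is componentwise at least `w x` and has the same weighted sum. Positive weights
force equality; a zero weight would leave one dual vector free to be suboptimal. -/
theorem dualPoint_eq_of_isOptimal (hw : IsDualValue X C d c w) {lam : Fin 2 → ℝ}
    (hlam : ∀ i, 0 < lam i) {x : Fin n → ℝ} {p : Fin 2 → Fin q → ℝ}
    (hopt : DA.IsOptimal X C d c lam (x, p)) : DA.dualPoint d p = w x := by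
  have h := (hw.of_isOptimal (fun i => (hlam i).le) hopt).1
  have hle : w x ≤ DA.dualPoint d p := (hw x hopt.1.1).2 ⟨p, hopt.1.2, rfl⟩
  rw [dualObjective_eq] at h
  change dotLin lam _ = _ at h
  rw [dotLin_apply, dotLin_apply] at h
  have h0 := mul_le_mul_of_nonneg_left (hle 0) (hlam 0).le
  have h1 := mul_le_mul_of_nonneg_left (hle 1) (hlam 1).le
  refine le_antisymm (Fin.forall_fin_two.2 ⟨?_, ?_⟩) hle
  · exact le_of_mul_le_mul_left (by linarith) (hlam 0)
  · exact le_of_mul_le_mul_left (by linarith) (hlam 1)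

end IsDualValue

/-- `x` minimizes first the `i`-th and then the `j`-th component of `w` over `X`. -/
def IsLexMin (X : Set (Fin n → ℝ)) (w : (Fin n → ℝ) → Fin 2 → ℝ) (i j : Fin 2) (x : Fin n → ℝ) :
    Prop :=
  x ∈ X ∧ (∀ y ∈ w '' X, w x i ≤ y i) ∧ ∀ y ∈ w '' X, y i ≤ w x i → w x j ≤ y j

theorem IsLexMin.isHullMinimal {i j : Fin 2} (hij : i ≠ j) {x : Fin n → ℝ}
    (h : IsLexMin X w i j x) : IsHullMinimal (w '' X) (w x) :=
  .of_lex hij ⟨x, h.1, rfl⟩ h.2.1 h.2.2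

theorem dotLin_single_zero (z : Fin 2 → ℝ) : dotLin ![1, 0] z = z 0 := by
  rw [dotLin_apply]
  simp

theorem dotLin_single_one (z : Fin 2 → ℝ) : dotLin ![0, 1] z = z 1 := by
  rw [dotLin_apply]
  simp

theorem zero_le_single_zero : (0 : Fin 2 → ℝ) ≤ ![1, 0] := Fin.forall_fin_two.2 (by simp)

theorem zero_le_single_one : (0 : Fin 2 → ℝ) ≤ ![0, 1] := Fin.forall_fin_two.2 (by simp)

/-- As `e` is the minimum of the `i`-th objective, the constraint selects exactly its minimizers.
Generic `i` and `j` serve both ends of the frontier. -/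
theorem isLexMin_of_isConstrainedArgmin (hw : IsDualValue X C d c w) {lam lam' : Fin 2 → ℝ}
    {i j : Fin 2} (hlam : 0 ≤ lam) (hlam' : 0 ≤ lam') (hi : ∀ z, dotLin lam z = z i)
    (hj : ∀ z, dotLin lam' z = z j) {e : ℝ} {x : Fin n → ℝ}
    (he : DA.IsOptimalValue X C d c lam e)
    (hx : DA.IsConstrainedArgmin X (DA.innerValue C d c lam') (DA.innerValue C d c lam) e x) :
    IsLexMin X w i j x ∧ w x i = e := by
  obtain ⟨⟨x₀, p₀⟩, hopt, rfl⟩ := he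
  obtain ⟨heq, hmin⟩ := hw.of_isOptimal hlam hopt
  obtain ⟨⟨hxX, hxe⟩, hxmin⟩ := hx
  rw [heq] at hxe hxmin ⊢
  simp only [hi] at hmin
  rw [hw.innerValue_eq hxX hlam, hi, hi] at hxe
  have hxi : w x i = w x₀ i := le_antisymm hxe (hmin _ ⟨x, hxX, rfl⟩)
  refine ⟨⟨hxX, fun y hy => hxi ▸ hmin y hy, ?_⟩, by rw [hi, hxi]⟩
  rintro _ ⟨x', hx', rfl⟩ hle
  have := hxmin x' hx' (by rw [hw.innerValue_eq hx' hlam, hi, hi]; exact hle.trans hxe)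
  rwa [hw.innerValue_eq hxX hlam', hw.innerValue_eq hx' hlam', hj, hj] at this

theorem exists_isConstrainedArgmin (hw : IsDualValue X C d c w) (hne : X.Nonempty)
    {V : Set (Fin 2 → ℝ)} (hV : V.Finite) (hVY : V ⊆ w '' X) (hYV : w '' X ⊆ convexHull ℝ V)
    {lam lam' : Fin 2 → ℝ} (hlam : 0 ≤ lam) (hlam' : 0 ≤ lam') :
    ∃ e x, DA.IsOptimalValue X C d c lam e ∧
      DA.IsConstrainedArgmin X (DA.innerValue C d c lam') (DA.innerValue C d c lam) e x := by
  obtain ⟨v, hv, hmin, hmin'⟩ :=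
    exists_lex_min hV hYV (hne.image w) (dotLin lam) (dotLin lam')
  obtain ⟨x, hx, rfl⟩ := hVY hv
  obtain ⟨p, hp, hpw⟩ := hw.exists_isOptimal hx hlam hmin
  refine ⟨dotLin lam (w x), x, ⟨_, hp, (hw.of_isOptimal hlam hp).1.symm⟩,
    ⟨hx, (hw.innerValue_eq hx hlam).le⟩, fun x' hx' hle => ?_⟩
  rw [hw.innerValue_eq hx' hlam] at hle
  rw [hw.innerValue_eq hx' hlam', hw.innerValue_eq hx hlam']
  exact hmin' _ ⟨x', hx', rfl⟩ hle

theorem exists_init (hw : IsDualValue X C d c w) (hne : X.Nonempty)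
    {V : Set (Fin 2 → ℝ)} (hV : V.Finite) (hVY : V ⊆ w '' X) (hYV : w '' X ⊆ convexHull ℝ V) :
    ∃ s, DA.Init X C d c s := by
  obtain ⟨e₁, xL, he₁, hxL⟩ := exists_isConstrainedArgmin hw hne hV hVY hYV
    zero_le_single_zero zero_le_single_one
  obtain ⟨e₂, xR, he₂, hxR⟩ := exists_isConstrainedArgmin hw hne hV hVY hYV
    zero_le_single_one zero_le_single_zero
  by_cases h : (![e₁, DA.innerValue C d c ![0, 1] xL] : Fin 2 → ℝ)
      = ![DA.innerValue C d c ![1, 0] xR, e₂]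
  · exact ⟨_, .single e₁ e₂ xL xR _ _ he₁ hxL rfl he₂ hxR rfl h⟩
  · exact ⟨_, .pair e₁ e₂ xL xR _ _ he₁ hxL rfl he₂ hxR rfl h⟩

theorem eq_worstCase_left (hw : IsDualValue X C d c w) {e : ℝ} {x : Fin n → ℝ}
    (he : DA.IsOptimalValue X C d c ![1, 0] e)
    (hx : DA.IsConstrainedArgmin X (DA.innerValue C d c ![0, 1]) (DA.innerValue C d c ![1, 0]) e x) :
    IsLexMin X w 0 1 x ∧ ![e, DA.innerValue C d c ![0, 1] x] = w x := by
  obtain ⟨hlex, hxe⟩ := isLexMin_of_isConstrainedArgmin hw zero_le_single_zero zero_le_single_one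
    dotLin_single_zero dotLin_single_one he hx
  refine ⟨hlex, funext (Fin.forall_fin_two.2 ⟨hxe.symm, ?_⟩)⟩
  exact (hw.innerValue_eq hlex.1 zero_le_single_one).trans (dotLin_single_one _)

theorem eq_worstCase_right (hw : IsDualValue X C d c w) {e : ℝ} {x : Fin n → ℝ}
    (he : DA.IsOptimalValue X C d c ![0, 1] e)
    (hx : DA.IsConstrainedArgmin X (DA.innerValue C d c ![1, 0]) (DA.innerValue C d c ![0, 1]) e x) :
    IsLexMin X w 1 0 x ∧ ![DA.innerValue C d c ![1, 0] x, e] = w x := by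
  obtain ⟨hlex, hxe⟩ := isLexMin_of_isConstrainedArgmin hw zero_le_single_one zero_le_single_zero
    dotLin_single_one dotLin_single_zero he hx
  refine ⟨hlex, funext (Fin.forall_fin_two.2 ⟨?_, hxe.symm⟩)⟩
  exact (hw.innerValue_eq hlex.1 zero_le_single_zero).trans (dotLin_single_zero _)

end optimality

/-! ### Loop invariant, termination and output -/

section run

variable {n m q : ℕ} {X : Set (Fin n → ℝ)} {C : Matrix (Fin q) (Fin m) ℝ} {d : Fin q → ℝ}
  {c : Fin 2 → (Fin n → ℝ) → Fin m → ℝ} {w : (Fin n → ℝ) → Fin 2 → ℝ}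

/-- The loop invariant of the algorithm. -/
structure LoopInvariant (X : Set (Fin n → ℝ)) (w : (Fin n → ℝ) → Fin 2 → ℝ) (s : DA.State n) :
    Prop where
  sols_subset : s.sols ⊆ X
  image_sols : w '' s.sols = s.points
  hullMinimal : ∀ y ∈ s.points, IsHullMinimal (w '' X) y
  todo : ∀ t ∈ s.todo,
    IsHullMinimal (w '' X) t.1 ∧ IsHullMinimal (w '' X) t.2 ∧ t.1 0 < t.2 0
  cover : ∀ y ∈ extremeSupportedPoints (w '' X),
    y ∈ s.points ∨ ∃ t ∈ s.todo, t.1 0 < y 0 ∧ y 0 < t.2 0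

/-- If `y ≠ u`, the single point `y` is a forbidden convex combination. This avoids first proving
`u` nondominated. -/
theorem IsHullMinimal.eq_of_le_extreme {Y : Set (Fin 2 → ℝ)} {y u : Fin 2 → ℝ}
    (hy : IsHullMinimal Y y) (hu : u ∈ extremeSupportedPoints Y) (h : y ≤ u) : u = y := by
  by_contra hne
  exact hu.2 ⟨y, subset_convexHull ℝ _ ⟨hy.mem_nondominatedPoints, Ne.symm hne⟩, h⟩

theorem eq_or_between_of_extreme {xL xR : Fin n → ℝ} (hL : IsLexMin X w 0 1 xL)
    (hR : IsLexMin X w 1 0 xR) {u : Fin 2 → ℝ} (hu : u ∈ extremeSupportedPoints (w '' X)) :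
    u = w xL ∨ u = w xR ∨ w xL 0 < u 0 ∧ u 0 < w xR 0 := by
  rcases (hL.2.1 u hu.1).eq_or_lt with h | h
  · left
    exact (hL.isHullMinimal zero_ne_one).eq_of_le_extreme hu
      (Fin.forall_fin_two.2 ⟨h.le, hL.2.2 u hu.1 h.ge⟩)
  · rcases lt_or_ge (u 0) (w xR 0) with h' | h'
    · exact Or.inr (Or.inr ⟨h, h'⟩)
    · right; left
      exact (hR.isHullMinimal one_ne_zero).eq_of_le_extreme hu
        (Fin.forall_fin_two.2 ⟨h', hR.2.1 u hu.1⟩)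

theorem loopInvariant_init (hw : IsDualValue X C d c w) {s : DA.State n}
    (h : DA.Init X C d c s) : LoopInvariant X w s := by
  cases h with
  | single e₁ e₂ xL xR yL yR he₁ hxL hyL he₂ hxR hyR heq =>
    obtain ⟨hL, hwL⟩ := eq_worstCase_left hw he₁ hxL
    obtain ⟨hR, hwR⟩ := eq_worstCase_right hw he₂ hxR
    rw [← hyL] at hwL
    rw [← hyR] at hwR
    subst hwL hwR
    refine ⟨by simpa using hL.1, by simp, ?_, by simp, fun u hu => Or.inl ?_⟩
    · rintro y rfl
      exact hL.isHullMinimal zero_ne_one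
    · rcases eq_or_between_of_extreme hL hR hu with h | h | h
      · exact h
      · exact h.trans heq.symm
      · rw [heq] at h
        exact absurd h.1 h.2.not_gt
  | pair e₁ e₂ xL xR yL yR he₁ hxL hyL he₂ hxR hyR hne =>
    obtain ⟨hL, hwL⟩ := eq_worstCase_left hw he₁ hxL
    obtain ⟨hR, hwR⟩ := eq_worstCase_right hw he₂ hxR
    rw [← hyL] at hwL
    rw [← hyR] at hwR
    subst hwL hwR
    have hL' := hL.isHullMinimal zero_ne_one
    have hR' := hR.isHullMinimal one_ne_zero
    refine ⟨by simp [Set.insert_subset_iff, hL.1, hR.1], Set.image_pair _ _ _, ?_, ?_,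
      fun u hu => ?_⟩
    · rintro y (rfl | rfl)
      exacts [hL', hR']
    · intro t ht
      rw [Multiset.mem_singleton] at ht
      subst ht
      refine ⟨hL', hR', lt_of_le_of_ne (hL.2.1 _ hR'.1) fun h => hne ?_⟩
      exact hL'.eq_of_zero_eq hR' h
    · rcases eq_or_between_of_extreme hL hR hu with h | h | h
      · exact Or.inl (Or.inl h)
      · exact Or.inl (Or.inr h)
      · exact Or.inr ⟨_, Multiset.mem_singleton_self _, h⟩

/-- What an iteration of the loop computes, in terms of the worst-case objective. -/
theorem iteration_spec (hw : IsDualValue X C d c w) {yl yr : Fin 2 → ℝ}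
    (hl : IsHullMinimal (w '' X) yl) (hr : IsHullMinimal (w '' X) yr) (hlr : yl 0 < yr 0)
    {x : Fin n → ℝ} {p : Fin 2 → Fin q → ℝ}
    (hopt : DA.IsOptimal X C d c (DA.weight yl yr) (x, p)) :
    x ∈ X ∧ DA.dualPoint d p = w x ∧ IsHullMinimal (w '' X) (w x) ∧
      ∀ y ∈ w '' X, dotLin (DA.weight yl yr) (w x) ≤ dotLin (DA.weight yl yr) y := by
  have hlam := hl.weight_pos hr hlr
  have hmin := (hw.of_isOptimal (fun i => (hlam i).le) hopt).2
  exact ⟨hopt.1.1, hw.dualPoint_eq_of_isOptimal hlam hopt,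
    .of_weight hlam ⟨x, hopt.1.1, rfl⟩ hmin, hmin⟩

theorem loopInvariant_step (hw : IsDualValue X C d c w) {s s' : DA.State n}
    (hs : LoopInvariant X w s) (h : DA.Step X C d c s s') : LoopInvariant X w s' := by
  cases h with
  | add yl yr L Y S x p hopt hne =>
    obtain ⟨hl, hr, hlr⟩ := hs.todo (yl, yr) (Multiset.mem_cons_self _ _)
    obtain ⟨hx, hpw, hy, hmin⟩ := iteration_spec hw hl hr hlr hopt
    rw [hpw] at hne ⊢
    have hlt : dotLin (DA.weight yl yr) (w x) < dotLin (DA.weight yl yr) yl :=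
      lt_of_le_of_ne (hmin _ hl.1) hne
    have hbt := hl.between_of_below hr hlr (subset_convexHull ℝ _ hy.1) hlt
    refine ⟨Set.insert_subset hx hs.sols_subset, ?_, ?_, ?_, fun u hu => ?_⟩
    · rw [Set.image_insert_eq, hs.image_sols]
    · rintro y (rfl | hyY)
      exacts [hy, hs.hullMinimal y hyY]
    · intro t ht
      rcases Multiset.mem_cons.1 ht with rfl | ht
      · exact ⟨hl, hy, hbt.1⟩
      rcases Multiset.mem_cons.1 ht with rfl | ht
      · exact ⟨hy, hr, hbt.2⟩
      · exact hs.todo t (Multiset.mem_cons_of_mem ht)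
    · rcases hs.cover u hu with h | ⟨t, ht, htu⟩
      · exact Or.inl (Or.inr h)
      rcases Multiset.mem_cons.1 ht with rfl | ht
      · rcases lt_trichotomy (u 0) (w x 0) with h | h | h
        · exact Or.inr ⟨_, Multiset.mem_cons_self _ _, htu.1, h⟩
        · left; left
          rcases le_total (w x 1) (u 1) with h1 | h1
          · exact hy.eq_of_le_extreme hu (Fin.forall_fin_two.2 ⟨h.ge, h1⟩)
          · exact hy.eq_of_le hu.1 (Fin.forall_fin_two.2 ⟨h.le, h1⟩)
        · exact Or.inr ⟨_, Multiset.mem_cons_of_mem (Multiset.mem_cons_self _ _), h, htu.2⟩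
      · exact Or.inr ⟨t, Multiset.mem_cons_of_mem (Multiset.mem_cons_of_mem ht), htu⟩
  | discard yl yr L Y S x p hopt heq =>
    obtain ⟨hl, hr, hlr⟩ := hs.todo (yl, yr) (Multiset.mem_cons_self _ _)
    obtain ⟨hx, hpw, hy, hmin⟩ := iteration_spec hw hl hr hlr hopt
    rw [hpw] at heq
    refine ⟨hs.sols_subset, hs.image_sols, hs.hullMinimal,
      fun t ht => hs.todo t (Multiset.mem_cons_of_mem ht), fun u hu => ?_⟩
    rcases hs.cover u hu with h | ⟨t, ht, htu⟩
    · exact Or.inl h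
    rcases Multiset.mem_cons.1 ht with rfl | ht
    · have heq' : dotLin (DA.weight yl yr) (w x) = dotLin (DA.weight yl yr) yl := heq
      exact (hl.not_extreme_between hr (fun z hz => heq' ▸ hmin z hz) hu htu.1 htu.2).elim
    · exact Or.inr ⟨t, ht, htu⟩

theorem loopInvariant_of_reachable (hw : IsDualValue X C d c w) {s : DA.State n}
    (h : DA.Reachable X C d c s) : LoopInvariant X w s := by
  obtain ⟨s₀, h₀, hrun⟩ := h
  induction hrun with
  | refl => exact loopInvariant_init hw h₀
  | tail _ hstep ih => exact loopInvariant_step hw ih hstep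

theorem exists_step (hw : IsDualValue X C d c w) {V : Set (Fin 2 → ℝ)} (hV : V.Finite)
    (hVY : V ⊆ w '' X) (hYV : w '' X ⊆ convexHull ℝ V) {s : DA.State n}
    (hs : LoopInvariant X w s) (hne : s.todo ≠ 0) : ∃ s', DA.Step X C d c s s' := by
  obtain ⟨T, Y, S⟩ := s
  obtain ⟨⟨yl, yr⟩, ht⟩ := Multiset.exists_mem_of_ne_zero hne
  obtain ⟨hl, hr, hlr⟩ := hs.todo _ ht
  obtain ⟨L, rfl⟩ := Multiset.exists_cons_of_mem ht
  -- Only attainment of the weighted minimum is needed, so the second functional is 0.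
  obtain ⟨v, hv, hmin, -⟩ := exists_lex_min hV hYV ⟨yl, hl.1⟩ (dotLin (DA.weight yl yr)) 0
  obtain ⟨x, hx, rfl⟩ := hVY hv
  obtain ⟨p, hp, hpw⟩ :=
    hw.exists_isOptimal hx (fun i => (hl.weight_pos hr hlr i).le) hmin
  by_cases h : DA.weight yl yr ⬝ᵥ DA.dualPoint d p = DA.weight yl yr ⬝ᵥ yl
  · exact ⟨_, .discard yl yr L Y S x p hp h⟩
  · exact ⟨_, .add yl yr L Y S x p hp h⟩

/-- A bound on the number of iterations that remain. -/
noncomputable def remainingWork (V : Set (Fin 2 → ℝ)) (s : DA.State n) : ℕ :=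
  (s.todo.map fun t => 3 ^ (pointsBetween V t.1 t.2).ncard).sum

theorem remainingWork_step_lt (hw : IsDualValue X C d c w) {V : Set (Fin 2 → ℝ)} (hV : V.Finite)
    (hVY : V ⊆ w '' X) (hYV : w '' X ⊆ convexHull ℝ V) {s s' : DA.State n}
    (hs : LoopInvariant X w s) (h : DA.Step X C d c s s') :
    remainingWork V s' < remainingWork V s := by
  cases h with
  | add yl yr L Y S x p hopt hne =>
    obtain ⟨hl, hr, hlr⟩ := hs.todo (yl, yr) (Multiset.mem_cons_self _ _)
    obtain ⟨hx, hpw, hy, hmin⟩ := iteration_spec hw hl hr hlr hopt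
    rw [hpw] at hne ⊢
    obtain ⟨h1, h2⟩ := ncard_pointsBetween_lt hV hVY hYV hl hr hlr hy.1 hmin
      (lt_of_le_of_ne (hmin _ hl.1) hne)
    simp only [remainingWork, Multiset.map_cons, Multiset.sum_cons] at h1 h2 ⊢
    -- A pair of weight `3 ^ (N + 1)` is replaced by two of weight at most `3 ^ N`, and `2 * 3 ^ N <
    -- 3 ^ (N + 1)`; base 2 would not give a strict decrease.
    generalize (pointsBetween V yl yr).ncard = N at h1 h2
    obtain ⟨N, rfl⟩ := Nat.exists_eq_succ_of_ne_zero (Nat.ne_zero_of_lt h1)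
    have h1' := Nat.pow_le_pow_right (n := 3) (by norm_num) (Nat.le_of_lt_succ h1)
    have h2' := Nat.pow_le_pow_right (n := 3) (by norm_num) (Nat.le_of_lt_succ h2)
    have h3 : 0 < 3 ^ N := by positivity
    rw [Nat.succ_eq_add_one, pow_succ]
    omega
  | discard yl yr L Y S x p hopt heq =>
    simp only [remainingWork, Multiset.map_cons, Multiset.sum_cons]
    have : 0 < 3 ^ (pointsBetween V yl yr).ncard := by positivity
    omega

theorem not_exists_infinite_run (hw : IsDualValue X C d c w) {V : Set (Fin 2 → ℝ)}
    (hV : V.Finite) (hVY : V ⊆ w '' X) (hYV : w '' X ⊆ convexHull ℝ V) :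
    ¬ ∃ σ : ℕ → DA.State n, DA.Init X C d c (σ 0) ∧ ∀ t, DA.Step X C d c (σ t) (σ (t + 1)) := by
  rintro ⟨σ, h₀, hstep⟩
  have hinv : ∀ t, LoopInvariant X w (σ t) := fun t => by
    induction t with
    | zero => exact loopInvariant_init hw h₀
    | succ t ih => exact loopInvariant_step hw ih (hstep t)
  obtain ⟨t, ht⟩ := WellFounded.not_rel_apply_succ (r := ((· < ·) : ℕ → ℕ → Prop))
    fun t => remainingWork V (σ t)
  exact ht (remainingWork_step_lt hw hV hVY hYV (hinv t) (hstep t))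

theorem LoopInvariant.output_correct {s : DA.State n} (hs : LoopInvariant X w s)
    (hdone : s.todo = 0) :
    extremeSupportedPoints (w '' X) ⊆ s.points ∧ s.points ⊆ supportedPoints (w '' X) ∧
      s.sols ⊆ X ∧ w '' s.sols = s.points ∧ ∃ S ⊆ s.sols, IsRepresentativeESE X w S := by
  have hcover : extremeSupportedPoints (w '' X) ⊆ s.points := fun u hu => by
    rcases hs.cover u hu with h | ⟨t, ht, -⟩
    · exact h
    · simp [hdone] at ht
  refine ⟨hcover, fun y hy => (hs.hullMinimal y hy).mem_supportedPoints, hs.sols_subset,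
    hs.image_sols, {x ∈ s.sols | w x ∈ extremeSupportedPoints (w '' X)}, Set.sep_subset _ _,
    (Set.sep_subset _ _).trans hs.sols_subset, ?_⟩
  apply Set.Subset.antisymm
  · rintro _ ⟨x, hx, rfl⟩
    exact hx.2
  · intro u hu
    obtain ⟨x, hx, rfl⟩ := hs.image_sols.ge (hcover hu)
    exact ⟨x, ⟨hx, hu⟩, rfl⟩

end run

theorem mainTheorem3 {n m r q : ℕ} (k : ℕ) (hk : k ≤ n)
    (A : Matrix (Fin r) (Fin n) ℝ) (b : Fin r → ℝ)
    (X : Set (Fin n → ℝ)) (hX : X = mixedIntegerPart k (polyhedron A b))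
    (hP : Bornology.IsBounded (polyhedron A b)) (hXne : X.Nonempty)
    (C : Matrix (Fin q) (Fin m) ℝ) (d : Fin q → ℝ)
    (U : Set (Fin m → ℝ)) (hU : U = polyhedron C d)
    (hUb : Bornology.IsBounded U) (hUne : U.Nonempty)
    (f : Fin 2 → (Fin n → ℝ) → (Fin m → ℝ) → ℝ)
    (hf : ∀ i, IsBilinearOn X U (f i))
    (c : Fin 2 → (Fin n → ℝ) → Fin m → ℝ)
    (hc : ∀ i, ∀ x ∈ X, ∀ ξ ∈ U, f i x ξ = c i x ⬝ᵥ ξ) :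
    -- the minimum that defines `g_λ(x)` is attained
    (∀ x ∈ X, ∀ lam : Fin 2 → ℝ, 0 ≤ lam →
      IsLeast (DA.dualObjective d lam '' DA.dualFeasible C c x) (DA.innerValue C d c lam x)) ∧
    -- the initialization can be carried out
    (∃ s, DA.Init X C d c s) ∧
    -- as long as the list is not empty, an iteration can be carried out
    (∀ s, DA.Reachable X C d c s → s.todo ≠ 0 → ∃ s', DA.Step X C d c s s') ∧
    -- every run terminates
    (¬ ∃ σ : ℕ → DA.State n, DA.Init X C d c (σ 0) ∧ ∀ t, DA.Step X C d c (σ t) (σ (t + 1))) ∧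
    -- the output of every run is correct
    (∀ s, DA.Reachable X C d c s → s.todo = 0 →
      extremeSupportedPoints (worstCase f U '' X) ⊆ s.points ∧
      s.points ⊆ supportedPoints (worstCase f U '' X) ∧
      s.sols ⊆ X ∧ worstCase f U '' s.sols = s.points ∧
      ∃ S ⊆ s.sols, IsRepresentativeESE X (worstCase f U) S) := by
  subst hU
  obtain ⟨V, hV, hVY, hYV⟩ :=
    exists_finite_subset_image_worstCase A b X hX hP C d _ rfl hUb hUne f hf c hc
  have hw := isDualValue_worstCase hUne hUb hc
  refine ⟨fun x hx lam hlam => ?_, exists_init hw hXne hV hVY hYV,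
    fun s hs => exists_step hw hV hVY hYV (loopInvariant_of_reachable hw hs),
    not_exists_infinite_run hw hV hVY hYV,
    fun s hs => (loopInvariant_of_reachable hw hs).output_correct⟩
  rw [hw.innerValue_eq hx hlam]
  exact hw.isLeast_dualObjective hx hlam
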